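/- All graphs are finite and simple, and $K_n$ is the complete graph on $[n]$. For graphs $G$ and $H$, a spanning subgraph $F\subseteq G$ is weakly $(G,H)$-saturated if $G$ can be obtained from $F$ by adding edges one by one so that every added edge, at the moment when it is added, belongs to a (not necessarily induced) copy of $H$ in the current graph; $\mathrm{wsat}(G,H)$ is the minimum number of edges in a weakly $(G,H)$-saturated graph. $G(n,p)$ is the binomial random graph on $[n]$, and $\delta(H)$ is the minimum degree of $H$. A property holds whp if its probability tends to $1$ as $n\to\infty$. Let $p\in(0,1)$ be constant. (1) Let $H$ be a graph with at least one vertex and without isolated vertices. Suppose that there is a constant $C$ such that for every $n\in\mathbb N$ there exist a weakly $(K_n,H)$-saturated graph $F_n$ with exactly $\mathrm{wsat}(K_n,H)$ edges and a set $S_n\subseteq[n]$ with $|S_n|\le C$ such that every vertex of $[n]\setminus S_n$ is adjacent in $F_n$ to at least $\delta(H)-1$ vertices of $S_n$. Then whp $\mathrm{wsat}(G(n,p),H)=\mathrm{wsat}(K_n,H)$. (2) For every $s\ge 2$, whp $\mathrm{wsat}(G(n,p),K_s)=\mathrm{wsat}(K_n,K_s)$. (3) For every $t\ge 1$, whp $\mathrm{wsat}(G(n,p),K_{t,t})=\mathrm{wsat}(K_n,K_{t,t})$.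 (4) For every $t\ge 1$, whp $\mathrm{wsat}(G(n,p),K_{t,t+1})=\mathrm{wsat}(K_n,K_{t,t+1})$. -/

import Mathlib

open Filter Topology

namespace WeakSat

/-- One step of the `H`-bootstrap percolation process: `F'` is obtained from `F` by adding an
edge `uv` that belongs to a copy of `H` in `F'`. The copy is a not necessarily induced one. -/
def Step {V W : Type*} (H : SimpleGraph W) (F F' : SimpleGraph V) : Prop :=
  ∃ u v : V, u ≠ v ∧ ¬ F.Adj u v ∧ F' = F ⊔ SimpleGraph.edge u v ∧
    ∃ (f : SimpleGraph.Copy H F') (a b : W), H.Adj a b ∧ f a = u ∧ f b = v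

/-- The spanning subgraph `F` of `G` is weakly `(G, H)`-saturated: `G` can be obtained from `F`
in finitely many steps of the `H`-bootstrap percolation process. The steps only add edges, so
every intermediate graph is a subgraph of `G`. -/
def WeaklySaturated {V W : Type*} (G : SimpleGraph V) (H : SimpleGraph W)
    (F : SimpleGraph V) : Prop :=
  F ≤ G ∧ Relation.ReflTransGen (Step H) F G

/-- The weak saturation number: the smallest number of edges in a weakly `(G, H)`-saturated
graph. The set is nonempty, as `G` itself is weakly `(G, H)`-saturated. -/
noncomputable def wsat {V W : Type*} (G : SimpleGraph V) (H : SimpleGraph W) : ℕ :=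
  sInf {m : ℕ | ∃ F : SimpleGraph V, WeaklySaturated G H F ∧ F.edgeSet.ncard = m}

/-- `F` contains a set `S` of at most `C` vertices such that every vertex outside `S` is adjacent
to at least `d` vertices of `S`. -/
def HasCore {V : Type*} (C d : ℕ) (F : SimpleGraph V) : Prop :=
  ∃ S : Finset V, S.card ≤ C ∧ ∀ v ∉ S, d ≤ {u | u ∈ S ∧ F.Adj v u}.ncard

/-- `F` is a minimum weakly `(G, H)`-saturated graph. -/
def IsMinWeaklySaturated {V W : Type*} (G : SimpleGraph V) (H : SimpleGraph W)
    (F : SimpleGraph V) : Prop :=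
  WeaklySaturated G H F ∧ F.edgeSet.ncard = wsat G H

/-- With high probability `wsat (G(n, p), H) = wsat (K_n, H)`: the probability of this event
in the binomial random graph on `n` vertices tends to `1` as `n → ∞`. -/
def Stable {W : Type*} (p : unitInterval) (H : SimpleGraph W) : Prop :=
  Tendsto (fun n : ℕ => SimpleGraph.binomialRandom (Fin n) p
      {G : SimpleGraph (Fin n) | wsat G H = wsat (⊤ : SimpleGraph (Fin n)) H})
    atTop (𝓝 1)

end WeakSat

/-! Everything about `G` is reduced to one property, `HasCommonNbrs k` with `k` fixed, which holds
whp by independence and a union bound. It makes `G` itself weakly saturated in the complete graph,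
so a process reaching `G` continues to `⊤`; hence `wsat G H ≥ wsat ⊤ H`.

For the reverse inequality put d = deg(w₀) - 1 for a suitable non-isolated vertex w₀ of `H`. For
fixed m, `HasCommonNbrs.wsat_le` plants an optimal graph on an m-clique of `G` and spends d edges on
each remaining vertex, so wsat(G) ≤ wsat(K_m) + (n - m)d. If wsat(K_n) ≥ nd - C for all n ≥ |W|,
then wsat(K_n) - nd is bounded below and attains its minimum there at some m; with this m the bound
is at most wsat(K_n) (`stable_of_le_wsat`).

It remains to prove wsat(K_n) ≥ nd - C. A core gives it by counting edges into `S`. For cliques and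
the two biclique families it comes from a linear algebra argument
(`HasBiclique.mul_le_ncard_edgeSet`). -/

namespace WeakSat

/-! ### Closed graphs and forced edges -/

/-- `F` is closed in `G`: every edge of `G` that completes a copy of `H` is already in `F`. -/
def ClosedIn {V W : Type*} (G : SimpleGraph V) (H : SimpleGraph W) (F : SimpleGraph V) : Prop :=
  ∀ u v, G.Adj u v → ∀ (f : SimpleGraph.Copy H (F ⊔ SimpleGraph.edge u v)) (a b : W),
    H.Adj a b → f a = u → f b = v → F.Adj u v

theorem Step.le {V W : Type*} {H : SimpleGraph W} {F F' : SimpleGraph V} (h : Step H F F') :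
    F ≤ F' := by
  obtain ⟨u, v, -, -, rfl, -⟩ := h
  exact le_sup_left

theorem le_of_reflTransGen {V W : Type*} {H : SimpleGraph W} {F F' : SimpleGraph V}
    (h : Relation.ReflTransGen (Step H) F F') : F ≤ F' := by
  induction h with
  | refl => exact le_rfl
  | tail _ h ih => exact ih.trans h.le

/-- A maximal graph reachable from `F` inside `G` is closed, so the order of the added edges need
never be tracked. -/
theorem weaklySaturated_of_forall_closedIn {V W : Type*} [Finite V] {G F : SimpleGraph V}
    {H : SimpleGraph W} (hFG : F ≤ G)
    (h : ∀ F', F ≤ F' → F' ≤ G → ClosedIn G H F' → F' = G) : WeaklySaturated G H F := by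
  obtain ⟨F', hF'⟩ := (Set.toFinite
    {F' | Relation.ReflTransGen (Step H) F F' ∧ F' ≤ G}).exists_maximal ⟨F, .refl, hFG⟩
  obtain ⟨⟨hr, hle⟩, hmax⟩ := hF'
  have hc : ClosedIn G H F' := by
    intro u v huv f a b hab ha hb
    by_contra hn
    have hle' : F' ⊔ SimpleGraph.edge u v ≤ G := by
      refine sup_le hle ?_
      intro x y hxy
      rw [SimpleGraph.edge_adj] at hxy
      rcases hxy with ⟨⟨rfl, rfl⟩ | ⟨rfl, rfl⟩, -⟩
      · exact huv
      · exact huv.symm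
    have := hmax ⟨hr.tail ⟨u, v, huv.ne, hn, rfl, f, a, b, hab, ha, hb⟩, hle'⟩ le_sup_left
    apply hn
    apply this
    rw [SimpleGraph.sup_adj, SimpleGraph.edge_adj]
    exact Or.inr ⟨Or.inl ⟨rfl, rfl⟩, huv.ne⟩
  have := h F' (le_of_reflTransGen hr) hle hc
  exact ⟨hFG, this ▸ hr⟩

theorem ClosedIn.adj_of_reflTransGen {U V W : Type*} {G F : SimpleGraph V} {H : SimpleGraph W}
    (hc : ClosedIn G H F) (e : U ↪ V) {A B : SimpleGraph U}
    (hAB : Relation.ReflTransGen (Step H) A B)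
    (hB : ∀ x y, B.Adj x y → G.Adj (e x) (e y)) (hA : ∀ x y, A.Adj x y → F.Adj (e x) (e y))
    (x y : U) (hxy : B.Adj x y) : F.Adj (e x) (e y) := by
  induction hAB generalizing x y with
  | refl => exact hA x y hxy
  | tail _ hs ih =>
    have ih' := ih fun x y h ↦ hB x y (hs.le h)
    obtain ⟨u, v, huv, -, rfl, f, a, b, hab, ha, hb⟩ := hs
    have key : F.Adj (e u) (e v) := by
      refine hc (e u) (e v) (hB u v ?_) ⟨⟨fun w ↦ e (f w), ?_⟩, ?_⟩ a b hab ?_ ?_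
      · simp [SimpleGraph.edge_adj, huv]
      · intro w w' hw
        have := f.toHom.map_adj hw
        rw [SimpleGraph.sup_adj, SimpleGraph.edge_adj] at this ⊢
        rcases this with h | ⟨h, hne⟩
        · exact Or.inl (ih' _ _ h)
        · refine Or.inr ⟨?_, e.injective.ne hne⟩
          rcases h with ⟨h1, h2⟩ | ⟨h1, h2⟩
          · exact Or.inl ⟨congrArg e h1, congrArg e h2⟩
          · exact Or.inr ⟨congrArg e h1, congrArg e h2⟩
      · exact e.injective.comp f.injective
      · exact congrArg e ha
      · exact congrArg e hb
    rw [SimpleGraph.sup_adj, SimpleGraph.edge_adj] at hxy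
    rcases hxy with h | ⟨⟨rfl, rfl⟩ | ⟨rfl, rfl⟩, -⟩
    · exact ih' _ _ h
    · exact key
    · exact key.symm

/-- Place `w₀` at `v`, `w₁` at `u`, the other neighbours of `w₀` in `N`, and the rest of `H`
anywhere in the clique: `vu` is the only edge that may be missing. -/
theorem ClosedIn.adj_of_clique {V W : Type*} [Fintype W] {G F : SimpleGraph V}
    {H : SimpleGraph W} [DecidableRel H.Adj] (hc : ClosedIn G H F) {w₀ w₁ : W}
    (h₀₁ : H.Adj w₀ w₁) {v u : V} {Q N : Finset V} (hQ : F.IsClique (Q : Set V)) (hvQ : v ∉ Q)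
    (huQ : u ∈ Q) (hNQ : N ⊆ Q) (hN : ∀ x ∈ N, F.Adj v x) (hNcard : H.degree w₀ ≤ N.card + 1)
    (hQcard : Fintype.card W ≤ Q.card + 1) (hG : G.Adj v u) : F.Adj v u := by
  classical
  by_contra hvu
  have huN : u ∉ N := fun h ↦ hvu (hN u h)
  set D : Finset W := (H.neighborFinset w₀).erase w₁ with hD
  have hDcard : D.card + 1 = H.degree w₀ := by
    rw [hD, Finset.card_erase_add_one (by simpa using h₀₁), SimpleGraph.card_neighborFinset_eq_degree]
  have hw₀D : w₀ ∉ D := by simp [hD]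
  have hw₁D : w₁ ∉ D := by simp [hD]
  obtain ⟨φ⟩ : Nonempty (D ↪ N) := by
    apply Function.Embedding.nonempty_of_card_le
    simp only [Fintype.card_coe]
    omega
  obtain ⟨f, hf0, hf1, hfD, hfi⟩ : ∃ f : W → V, f w₀ = v ∧ f w₁ = u ∧ (∀ w ∈ D, f w ∈ N) ∧
      Set.InjOn f D := by
    refine ⟨fun w ↦ if w = w₀ then v else if h : w ∈ D then φ ⟨w, h⟩ else u, ?_, ?_, ?_, ?_⟩
    · simp
    · simp [hw₁D, h₀₁.ne']
    · intro w hw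
      have : w ≠ w₀ := fun h ↦ hw₀D (h ▸ hw)
      simp [this, hw]
    · intro w hw w' hw' h
      have h1 : w ≠ w₀ := fun h ↦ hw₀D (h ▸ hw)
      have h2 : w' ≠ w₀ := fun h ↦ hw₀D (h ▸ hw')
      have hw : w ∈ D := hw
      have hw' : w' ∈ D := hw'
      simp only [h1, h2, hw, hw', if_false, dif_pos] at h
      simpa using φ.injective (Subtype.ext h)
  set T := insert w₀ (insert w₁ D) with hT
  have hTcard : T.card = D.card + 2 := by
    rw [hT, Finset.card_insert_of_notMem, Finset.card_insert_of_notMem hw₁D]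
    simp [hw₀D, h₀₁.ne]
  have hfQ : (insert w₁ D).image f ⊆ Q := by
    intro x hx
    simp only [Finset.mem_image, Finset.mem_insert] at hx
    obtain ⟨w, rfl | hw, rfl⟩ := hx
    · rwa [hf1]
    · exact hNQ (hfD w hw)
  have hinjT : Set.InjOn f T := by
    intro x hx y hy hxy
    simp only [hT, Finset.coe_insert, Set.mem_insert_iff, Finset.mem_coe] at hx hy
    rcases hx with rfl | rfl | hx <;> rcases hy with rfl | rfl | hy
    · rfl
    · rw [hf0, hf1] at hxy; exact absurd (hxy ▸ huQ) hvQ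
    · rw [hf0] at hxy; exact absurd (hNQ (hxy ▸ hfD y hy)) hvQ
    · rw [hf0, hf1] at hxy; exact absurd (hxy ▸ huQ) hvQ
    · rfl
    · rw [hf1] at hxy; exact absurd (hxy ▸ hfD y hy) huN
    · rw [hf0] at hxy; exact absurd (hNQ (hxy ▸ hfD x hx)) hvQ
    · rw [hf1] at hxy; exact absurd (hxy ▸ hfD x hx) huN
    · exact hfi hx hy hxy
  obtain ⟨Q', hQ'1, hQ'2, hQ'3⟩ := Finset.exists_subsuperset_card_eq (n := Fintype.card W - 1) hfQ
    (by
      have h1 : T.card ≤ Fintype.card W := Finset.card_le_univ T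
      have h2 := Finset.card_image_le (s := insert w₁ D) (f := f)
      have h3 := Finset.card_insert_le w₁ D
      omega) (by omega)
  have hvQ' : v ∉ Q' := fun h ↦ hvQ (hQ'2 h)
  have hW : 0 < Fintype.card W := Fintype.card_pos_iff.2 ⟨w₀⟩
  obtain ⟨g, hg⟩ := Finset.exists_equiv_extend_of_card_eq (t := insert v Q') (s := T) (f := f)
    (by rw [Finset.card_insert_of_notMem hvQ', hQ'3]; omega)
    (by
      rw [hT, Finset.image_insert, hf0]
      exact Finset.insert_subset_insert _ hQ'1) hinjT
  have hg0 : (g w₀ : V) = v := by rw [hg w₀ (by simp [hT]), hf0]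
  have hg1 : (g w₁ : V) = u := by rw [hg w₁ (by simp [hT]), hf1]
  have hginj : Function.Injective fun w ↦ (g w : V) := Subtype.val_injective.comp g.injective
  have hgQ : ∀ w, w ≠ w₀ → (g w : V) ∈ Q := by
    intro w hw
    rcases Finset.mem_insert.1 (g w).2 with h | h
    · exact absurd (hginj (h.trans hg0.symm)) hw
    · exact hQ'2 h
  have hadj0 : ∀ w, H.Adj w₀ w → (F ⊔ SimpleGraph.edge v u).Adj (g w₀) (g w) := by
    intro w hw
    rw [SimpleGraph.sup_adj, SimpleGraph.edge_adj, hg0]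
    by_cases h : w = w₁
    · subst h
      exact Or.inr ⟨Or.inl ⟨rfl, hg1⟩, by rw [hg1]; exact hG.ne⟩
    · have hwD : w ∈ D := by simp [hD, h, hw]
      left
      rw [hg w (by simp [hT, hwD])]
      exact hN _ (hfD w hwD)
  refine hvu (hc v u hG ⟨⟨fun w ↦ (g w : V), ?_⟩, hginj⟩ w₀ w₁ h₀₁ hg0 hg1)
  intro a b hab
  by_cases ha : a = w₀
  · subst ha; exact hadj0 b hab
  · by_cases hb : b = w₀
    · subst hb; exact (hadj0 a hab.symm).symm
    · exact Or.inl (hQ (hgQ a ha) (hgQ b hb) (hginj.ne hab.ne))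

/-! ### Common neighbours and common cliques -/

/-- Every set of at most `k` vertices has a common neighbour. -/
def HasCommonNbrs {V : Type*} (k : ℕ) (G : SimpleGraph V) : Prop :=
  ∀ X : Finset V, X.card ≤ k → ∃ v, ∀ x ∈ X, G.Adj x v

theorem HasCommonNbrs.exists_clique {V : Type*} {k : ℕ} {G : SimpleGraph V}
    (hG : HasCommonNbrs k G) (X : Finset V) (r : ℕ) (hr : X.card + r ≤ k + 1) :
    ∃ R : Finset V, R.card = r ∧ G.IsClique (R : Set V) ∧ ∀ x ∈ X, ∀ y ∈ R, G.Adj x y := by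
  classical
  induction r with
  | zero => exact ⟨∅, by simp⟩
  | succ r ih =>
    obtain ⟨R, hR, hRc, hXR⟩ := ih (by omega)
    obtain ⟨v, hv⟩ := hG (X ∪ R) ((Finset.card_union_le _ _).trans (by omega))
    have hvR : v ∉ R := fun h ↦ (hv v (Finset.mem_union_right _ h)).ne rfl
    refine ⟨insert v R, by rw [Finset.card_insert_of_notMem hvR, hR], ?_, ?_⟩
    · rw [Finset.coe_insert, SimpleGraph.isClique_insert]
      exact ⟨hRc, fun b hb _ ↦ (hv b (Finset.mem_union_right _ hb)).symm⟩
    · intro x hx y hy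
      rcases Finset.mem_insert.1 hy with rfl | hy
      · exact hv x (Finset.mem_union_left _ hx)
      · exact hXR x hx y hy

theorem ClosedIn.adj_of_common_clique {V W : Type*} [Fintype W] {G F : SimpleGraph V}
    {H : SimpleGraph W} [DecidableRel H.Adj] (hc : ClosedIn G H F) {w₀ w₁ : W}
    (h₀₁ : H.Adj w₀ w₁) {v u : V} {R : Finset V} (hR : F.IsClique (R : Set V))
    (hvR : ∀ x ∈ R, F.Adj v x) (huR : ∀ x ∈ R, F.Adj u x)
    (hcard : Fintype.card W ≤ R.card + 2) (hG : G.Adj v u) : F.Adj v u := by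
  classical
  have huR' : u ∉ R := fun h ↦ (huR u h).ne rfl
  have hvR' : v ∉ R := fun h ↦ (hvR v h).ne rfl
  have hd := H.degree_lt_card_verts w₀
  refine hc.adj_of_clique h₀₁ (Q := insert u R) (N := R) ?_ ?_ (Finset.mem_insert_self _ _)
    (Finset.subset_insert _ _) hvR (by omega)
    (by rw [Finset.card_insert_of_notMem huR']; omega) hG
  · rw [Finset.coe_insert, SimpleGraph.isClique_insert]
    exact ⟨hR, fun b hb _ ↦ huR b hb⟩
  · simp [hvR', hG.ne]

theorem HasCommonNbrs.weaklySaturated_top {V W : Type*} [Finite V] [Fintype W] {k : ℕ}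
    {G : SimpleGraph V} {H : SimpleGraph W} {w₀ w₁ : W} (h₀₁ : H.Adj w₀ w₁)
    (hG : HasCommonNbrs k G) (hk : Fintype.card W + 1 ≤ k) : WeaklySaturated ⊤ H G := by
  classical
  refine weaklySaturated_of_forall_closedIn le_top fun F hGF _ hc ↦ ?_
  rw [eq_top_iff]
  intro u v huv
  obtain ⟨R, hR, hRc, hXR⟩ := hG.exists_clique {u, v} (Fintype.card W)
    (by have := Finset.card_le_two (a := u) (b := v); omega)
  exact hc.adj_of_common_clique h₀₁ (hRc.mono hGF) (fun x hx ↦ hGF (hXR u (by simp) x hx))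
    (fun x hx ↦ hGF (hXR v (by simp) x hx)) (by omega) huv

/-! ### Deterministic bounds on the weak saturation number -/

theorem wsat_le {V W : Type*} {G F : SimpleGraph V} {H : SimpleGraph W}
    (h : WeaklySaturated G H F) : wsat G H ≤ F.edgeSet.ncard :=
  Nat.sInf_le ⟨F, h, rfl⟩

theorem exists_isMinWeaklySaturated {V W : Type*} (G : SimpleGraph V) (H : SimpleGraph W) :
    ∃ F, IsMinWeaklySaturated G H F :=
  Nat.sInf_mem (s := {m : ℕ | ∃ F : SimpleGraph V, WeaklySaturated G H F ∧ F.edgeSet.ncard = m})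
    ⟨_, G, ⟨le_rfl, .refl⟩, rfl⟩

theorem wsat_top_le {V W : Type*} {G : SimpleGraph V} {H : SimpleGraph W}
    (h : WeaklySaturated ⊤ H G) : wsat (⊤ : SimpleGraph V) H ≤ wsat G H := by
  obtain ⟨F, hF, hcard⟩ := exists_isMinWeaklySaturated G H
  rw [← hcard]
  exact wsat_le ⟨le_top, hF.2.trans h.2⟩

theorem ncard_edgeSet_fromEdgeSet_le {V : Type*} (s : Finset (Sym2 V)) :
    (SimpleGraph.fromEdgeSet (s : Set (Sym2 V))).edgeSet.ncard ≤ s.card := by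
  rw [SimpleGraph.edgeSet_fromEdgeSet, ← Set.ncard_coe_finset]
  exact Set.ncard_le_ncard Set.sdiff_subset s.finite_toSet

/-- `B` is the common neighbourhood of an m-clique `K`. A vertex of `B` sends its edges into `K`;
any other vertex outside `K` sends them into a clique `Q v` inside `B`. In a closed graph this
fills, in turn, `K`, the pairs between `B` and `K`, the edges of `G` inside `B`, those meeting `B`,
and all the others. -/
theorem HasCommonNbrs.wsat_le {V W : Type*} [Fintype V] [Fintype W] {k m : ℕ}
    {G : SimpleGraph V} {H : SimpleGraph W} [DecidableRel H.Adj] {w₀ w₁ : W} (h₀₁ : H.Adj w₀ w₁)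
    (hG : HasCommonNbrs k G) (hm : Fintype.card W ≤ m) (hk : m + 2 * Fintype.card W + 2 ≤ k) :
    wsat G H ≤ wsat (⊤ : SimpleGraph (Fin m)) H + (Fintype.card V - m) * (H.degree w₀ - 1) := by
  classical
  have hd := H.degree_lt_card_verts w₀
  obtain ⟨K, hK, hKc, -⟩ := hG.exists_clique ∅ m (by simp; omega)
  let e : Fin m ≃ K := (K.equivFinOfCardEq hK).symm
  obtain ⟨A, hA, hAcard⟩ := exists_isMinWeaklySaturated (⊤ : SimpleGraph (Fin m)) H
  set B : Set V := {v | ∀ x ∈ K, G.Adj x v} with hB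
  have hBK : ∀ v ∈ B, v ∉ K := fun v hv h ↦ (hv v h).ne rfl
  have hex : ∀ v : V, ∃ N Q : Finset V, v ∉ K → (N ⊆ Q ∧ N.card = H.degree w₀ - 1 ∧
      Fintype.card W ≤ Q.card ∧ G.IsClique (Q : Set V) ∧ (∀ x ∈ Q, G.Adj v x) ∧
      (v ∈ B → Q = K) ∧ (v ∉ B → (∀ x ∈ Q, x ∈ B) ∧ Q.card = Fintype.card W)) := by
    intro v
    by_cases hv : v ∈ B
    · obtain ⟨N, hN, hNc⟩ := Finset.exists_subset_card_eq (s := K) (n := H.degree w₀ - 1) (by omega)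
      exact ⟨N, K, fun _ ↦ ⟨hN, hNc, by omega, hKc, fun x hx ↦ (hv x hx).symm, fun _ ↦ rfl,
        fun h ↦ absurd hv h⟩⟩
    · obtain ⟨Q, hQ, hQc, hQa⟩ := hG.exists_clique (insert v K) (Fintype.card W)
        (by have := Finset.card_insert_le v K; omega)
      obtain ⟨N, hN, hNc⟩ := Finset.exists_subset_card_eq (s := Q) (n := H.degree w₀ - 1) (by omega)
      exact ⟨N, Q, fun _ ↦ ⟨hN, hNc, by omega, hQc, fun x hx ↦ hQa v (by simp) x hx,
        fun h ↦ absurd h hv, fun _ ↦ ⟨fun x hx y hy ↦ hQa y (by simp [hy]) x hx, hQ⟩⟩⟩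
  choose N Q hNQ using hex
  set S : Finset (Sym2 V) := A.edgeFinset.image (Sym2.map fun i ↦ (e i : V)) ∪
    (Finset.univ \ K).biUnion fun v ↦ (N v).image fun x ↦ s(v, x) with hS
  have hScard : S.card ≤ wsat (⊤ : SimpleGraph (Fin m)) H +
      (Fintype.card V - m) * (H.degree w₀ - 1) := by
    refine (Finset.card_union_le _ _).trans (add_le_add ?_ ?_)
    · refine Finset.card_image_le.trans ?_
      rw [← hAcard, ← SimpleGraph.coe_edgeFinset, Set.ncard_coe_finset]
    · refine (Finset.card_biUnion_le_card_mul _ _ (H.degree w₀ - 1) ?_).trans ?_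
      · intro v hv
        refine Finset.card_image_le.trans ?_
        rw [(hNQ v (by simpa using hv)).2.1]
      · rw [Finset.card_sdiff_of_subset (Finset.subset_univ K), hK, Finset.card_univ]
  refine le_trans (WeakSat.wsat_le ?_) ((ncard_edgeSet_fromEdgeSet_le S).trans hScard)
  have heK : ∀ i j, i ≠ j → G.Adj (e i : V) (e j) := fun i j hij ↦
    hKc (e i).2 (e j).2 fun h ↦ hij (e.injective (Subtype.ext h))
  refine weaklySaturated_of_forall_closedIn ?_ fun F hSF hFG hc ↦ le_antisymm hFG ?_
  · rw [SimpleGraph.fromEdgeSet_le]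
    rintro s ⟨hs, -⟩
    simp only [hS, Finset.coe_union, Set.mem_union, Finset.mem_coe, Finset.mem_image,
      Finset.mem_biUnion, SimpleGraph.mem_edgeFinset] at hs
    rcases hs with ⟨t, ht, rfl⟩ | ⟨v, hv, x, hx, rfl⟩
    · induction t with | _ i j
      exact heK i j (SimpleGraph.Adj.ne ht)
    · obtain ⟨h1, -, -, -, h5, -⟩ := hNQ v (by simpa using hv)
      exact h5 x (h1 hx)
  have hFA : ∀ i j, A.Adj i j → F.Adj (e i : V) (e j) := by
    intro i j hij
    apply hSF
    rw [SimpleGraph.fromEdgeSet_adj]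
    refine ⟨?_, (heK i j hij.ne).ne⟩
    simp only [hS, Finset.coe_union, Set.mem_union, Finset.mem_coe, Finset.mem_image]
    exact Or.inl ⟨s(i, j), by simpa using hij, rfl⟩
  have hFN : ∀ v ∉ K, ∀ x ∈ N v, F.Adj v x := by
    intro v hv x hx
    apply hSF
    rw [SimpleGraph.fromEdgeSet_adj]
    obtain ⟨h1, -, -, -, h5, -⟩ := hNQ v hv
    refine ⟨?_, (h5 x (h1 hx)).ne⟩
    simp only [hS, Finset.coe_union, Set.mem_union, Finset.mem_coe, Finset.mem_biUnion,
      Finset.mem_image]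
    exact Or.inr ⟨v, by simpa using hv, x, hx, rfl⟩
  have hFK : F.IsClique (K : Set V) := by
    intro x hx y hy hxy
    have := hc.adj_of_reflTransGen (e.toEmbedding.trans (Function.Embedding.subtype _)) hA.2
      (fun i j hij ↦ heK i j hij.ne) hFA (e.symm ⟨x, hx⟩) (e.symm ⟨y, hy⟩)
      (by simpa using hxy)
    simpa using this
  have hFBK : ∀ v ∈ B, ∀ x ∈ K, F.Adj v x := by
    intro v hv x hx
    obtain ⟨h1, h2, h3, h4, h5, h6, -⟩ := hNQ v (hBK v hv)
    rw [h6 hv] at h1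
    exact hc.adj_of_clique h₀₁ hFK (hBK v hv) hx h1 (hFN v (hBK v hv)) (by omega) (by omega)
      (hv x hx).symm
  have hFB : ∀ v ∈ B, ∀ w ∈ B, G.Adj v w → F.Adj v w := fun v hv w hw hvw ↦
    hc.adj_of_common_clique h₀₁ hFK (hFBK v hv) (hFBK w hw) (by omega) hvw
  have hFVB : ∀ v, ∀ w ∈ B, G.Adj v w → F.Adj v w := by
    intro v w hw hvw
    by_cases hvK : v ∈ K
    · exact (hFBK w hw v hvK).symm
    by_cases hvB : v ∈ B
    · exact hFB v hvB w hw hvw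
    obtain ⟨h1, h2, h3, h4, h5, -, h7⟩ := hNQ v hvK
    obtain ⟨h7, h8⟩ := h7 hvB
    -- `R` bridges `Q v` and `w`: since `Q v ∪ R` is a clique, `v` becomes joined to `R`, and then
    -- `R` is a common clique of `v` and `w`. This choice dictates the size of `k`.
    obtain ⟨R, hR, hRc, hRa⟩ := hG.exists_clique (insert v (insert w (K ∪ Q v))) (Fintype.card W)
      (by
        have a1 := Finset.card_insert_le v (insert w (K ∪ Q v))
        have a2 := Finset.card_insert_le w (K ∪ Q v)
        have a3 := Finset.card_union_le K (Q v)
        omega)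
    have hRB : ∀ x ∈ R, x ∈ B := fun x hx y hy ↦ hRa y (by simp [hy]) x hx
    have hRF : F.IsClique (R : Set V) := fun x hx y hy hxy ↦
      hFB x (hRB x hx) y (hRB y hy) (hRc hx hy hxy)
    have hQR : F.IsClique ((Q v ∪ R : Finset V) : Set V) := by
      intro x hx y hy hxy
      rw [Finset.coe_union] at hx hy
      rcases hx with hx | hx <;> rcases hy with hy | hy
      · exact hFB x (h7 x hx) y (h7 y hy) (h4 hx hy hxy)
      · exact hFB x (h7 x hx) y (hRB y hy) (hRa x (by simp [Finset.mem_coe.1 hx]) y hy)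
      · exact hFB x (hRB x hx) y (h7 y hy) (hRa y (by simp [Finset.mem_coe.1 hy]) x hx).symm
      · exact hRF hx hy hxy
    have hvR : ∀ x ∈ R, F.Adj v x := by
      intro x hx
      refine hc.adj_of_clique h₀₁ hQR ?_ (Finset.mem_union_right _ hx)
        (h1.trans Finset.subset_union_left) (hFN v hvK) (by omega) ?_ (hRa v (by simp) x hx)
      · rw [Finset.mem_union]
        rintro (h | h)
        · exact hvB (h7 v h)
        · exact hvB (hRB v h)
      · have := Finset.card_le_card (Finset.subset_union_left (s₁ := Q v) (s₂ := R))
        omega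
    exact hc.adj_of_common_clique h₀₁ hRF hvR
      (fun x hx ↦ hFB w hw x (hRB x hx) (hRa w (by simp) x hx)) (by omega) hvw
  intro v w hvw
  obtain ⟨R, hR, hRc, hRa⟩ := hG.exists_clique (insert v (insert w K)) (Fintype.card W)
    (by
      have a1 := Finset.card_insert_le v (insert w K)
      have a2 := Finset.card_insert_le w K
      omega)
  have hRB : ∀ x ∈ R, x ∈ B := fun x hx y hy ↦ hRa y (by simp [hy]) x hx
  exact hc.adj_of_common_clique h₀₁
    (fun x hx y hy hxy ↦ hFB x (hRB x hx) y (hRB y hy) (hRc hx hy hxy))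
    (fun x hx ↦ hFVB v x (hRB x hx) (hRa v (by simp) x hx))
    (fun x hx ↦ hFVB w x (hRB x hx) (hRa w (by simp) x hx)) (by omega) hvw

/-! ### Common neighbours in the binomial random graph -/

open MeasureTheory ProbabilityTheory unitInterval in
theorem infinitePi_forall_not_forall {ι α : Type*} [Finite ι] (ν : ι → Measure Prop)
    [∀ i, IsProbabilityMeasure (ν i)] (T : α → Finset ι) (s : Finset α)
    (hT : (s : Set α).PairwiseDisjoint T) :
    Measure.infinitePi ν {ω | ∀ a ∈ s, ¬ ∀ i ∈ T a, ω i} =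
      ∏ a ∈ s, (1 - ∏ i ∈ T a, ν i {True}) := by
  classical
  have hone (a : α) : Measure.infinitePi ν {ω | ¬ ∀ i ∈ T a, ω i} =
      1 - ∏ i ∈ T a, ν i {True} := by
    have h : {ω : ι → Prop | ∀ i ∈ T a, ω i} = Set.pi (T a : Set ι) fun _ ↦ {True} := by
      ext ω; simp
    have h' : {ω : ι → Prop | ¬ ∀ i ∈ T a, ω i} = {ω : ι → Prop | ∀ i ∈ T a, ω i}ᶜ := rfl
    rw [h', prob_compl_eq_one_sub, h, Measure.infinitePi_pi]
    · simp
    · rw [h]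
      exact MeasurableSet.pi (Finset.countable_toSet _) fun _ _ ↦ .of_discrete
  induction s using Finset.induction_on with
  | empty => simp
  | insert a s ha ih =>
    rw [Finset.prod_insert ha, ← hone a, ← ih (hT.subset (by simp))]
    have hdisj : Disjoint (T a) (s.biUnion T) := by
      rw [Finset.disjoint_biUnion_right]
      intro b hb
      exact hT (by simp) (by simp [hb]) (by rintro rfl; exact ha hb)
    have hind := (iIndepFun_infinitePi (P := ν) (X := fun _ x ↦ x)
      (fun _ ↦ measurable_id)).indepFun_finset (T a) (s.biUnion T) hdisj
      (fun i ↦ measurable_pi_apply i)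
    have h := hind.measure_inter_preimage_eq_mul {g | ¬ ∀ i, g i}
      {g | ∀ b, ∀ hb : b ∈ s, ¬ ∀ i, ∀ hi : i ∈ T b, g ⟨i, Finset.mem_biUnion.2 ⟨b, hb, hi⟩⟩}
      .of_discrete .of_discrete
    have h1 : (fun (ω : ι → Prop) (i : T a) ↦ ω i) ⁻¹' {g | ¬ ∀ i, g i} =
        {ω | ¬ ∀ i ∈ T a, ω i} := by
      ext ω; simp
    have h2 : (fun (ω : ι → Prop) (i : s.biUnion T) ↦ ω i) ⁻¹' {g | ∀ b, ∀ hb : b ∈ s,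
        ¬ ∀ i, ∀ hi : i ∈ T b, g ⟨i, Finset.mem_biUnion.2 ⟨b, hb, hi⟩⟩} =
        {ω | ∀ b ∈ s, ¬ ∀ i ∈ T b, ω i} := rfl
    rw [h1, h2] at h
    rw [← h]
    refine congrArg (Measure.infinitePi ν) ?_
    ext ω
    simp

open MeasureTheory ProbabilityTheory unitInterval in
-- Distinct vertices outside `X` use disjoint sets of potential edges to `X`, so their failures are
-- independent.
theorem binomialRandom_forall_not_forall_adj_le {V : Type*} [Fintype V] [DecidableEq V]
    (p : unitInterval) (X : Finset V) :
    SimpleGraph.binomialRandom V p {G | ¬ ∃ v, ∀ x ∈ X, G.Adj x v} ≤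
      (1 - (toNNReal p : ENNReal) ^ X.card) ^ (Fintype.card V - X.card) := by
  rw [SimpleGraph.binomialRandom_apply', setBernoulli_apply']
  have hle : (fun q : Sym2 V → Prop ↦ {i | q i}) ⁻¹'
      (SimpleGraph.edgeSet '' {G | ¬ ∃ v, ∀ x ∈ X, G.Adj x v}) ⊆
      {ω | ∀ v ∈ Finset.univ \ X, ¬ ∀ i ∈ X.image fun x ↦ s(x, v), ω i} := by
    rintro ω ⟨G, hG, hGω⟩ v - hv
    refine hG ⟨v, fun x hx ↦ ?_⟩
    have : s(x, v) ∈ {i | ω i} := hv _ (Finset.mem_image_of_mem _ hx)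
    change G.edgeSet = {i | ω i} at hGω
    rwa [← hGω] at this
  refine (measure_mono hle).trans ?_
  rw [infinitePi_forall_not_forall]
  · refine (Finset.prod_congr rfl (g := fun _ ↦ 1 - (toNNReal p : ENNReal) ^ X.card) ?_).trans_le ?_
    · intro v hv
      have hvX : v ∉ X := by simpa using hv
      congr 1
      rw [Finset.prod_image (fun x _ y _ h ↦ Sym2.congr_left.1 h)]
      rw [← Finset.prod_const]
      refine Finset.prod_congr rfl fun x hx ↦ ?_
      have : x ≠ v := fun h ↦ hvX (h ▸ hx)
      simp [this]
    · rw [Finset.prod_const, Finset.card_sdiff_of_subset (Finset.subset_univ X), Finset.card_univ]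
  · intro v hv w hw hvw
    rw [Function.onFun, Finset.disjoint_left]
    simp only [Finset.mem_image, not_exists, not_and]
    rintro _ ⟨x, hx, rfl⟩ y hy h
    have hvX : v ∉ X := by simpa using hv
    rw [Sym2.eq_iff] at h
    rcases h with ⟨-, h⟩ | ⟨h, -⟩
    · exact hvw h.symm
    · exact hvX (h ▸ hy)

open MeasureTheory unitInterval in
theorem binomialRandom_not_hasCommonNbrs_le (p : unitInterval) {n k : ℕ} (hk : k ≤ n) :
    SimpleGraph.binomialRandom (Fin n) p {G | ¬ HasCommonNbrs k G} ≤
      (n : ENNReal) ^ k * (1 - (toNNReal p : ENNReal) ^ k) ^ (n - k) := by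
  have hsub : {G : SimpleGraph (Fin n) | ¬ HasCommonNbrs k G} ⊆
      ⋃ X ∈ Finset.powersetCard k (Finset.univ : Finset (Fin n)),
        {G | ¬ ∃ v, ∀ x ∈ X, G.Adj x v} := by
    intro G hG
    simp only [HasCommonNbrs, Set.mem_ofPred_eq, not_forall] at hG
    obtain ⟨X, hX, hG⟩ := hG
    obtain ⟨Y, hXY, -, hY⟩ := Finset.exists_subsuperset_card_eq (Finset.subset_univ X) hX
      (by simpa using hk)
    simp only [Set.mem_iUnion, Finset.mem_powersetCard]
    exact ⟨Y, ⟨Finset.subset_univ _, hY⟩, fun ⟨v, hv⟩ ↦ hG ⟨v, fun x hx ↦ hv x (hXY hx)⟩⟩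
  refine (measure_mono hsub).trans ((measure_biUnion_finset_le _ _).trans ?_)
  refine (Finset.sum_le_card_nsmul _ _ ((1 - (toNNReal p : ENNReal) ^ k) ^ (n - k)) ?_).trans ?_
  · intro X hX
    have := binomialRandom_forall_not_forall_adj_le p X
    rwa [(Finset.mem_powersetCard.1 hX).2, Fintype.card_fin] at this
  · rw [nsmul_eq_mul, Finset.card_powersetCard, Finset.card_univ, Fintype.card_fin]
    gcongr
    exact_mod_cast Nat.choose_le_pow n k

open unitInterval in
theorem tendsto_binomialRandom_not_hasCommonNbrs (p : unitInterval) (hp0 : 0 < p) (k : ℕ) :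
    Tendsto (fun n : ℕ ↦ SimpleGraph.binomialRandom (Fin n) p {G | ¬ HasCommonNbrs k G})
      atTop (𝓝 0) := by
  have hp : (0 : ℝ) < p := hp0
  have hp1 : (p : ℝ) ≤ 1 := p.2.2
  obtain ⟨r, hr0, hr1, hr⟩ : ∃ r : ℝ, 0 < r ∧ r < 1 ∧ 1 - (p : ℝ) ^ k ≤ r := by
    -- The `1 / 2` only keeps `r` positive, so that `r ^ k` can be inverted.
    refine ⟨max (1 - (p : ℝ) ^ k) (1 / 2), by positivity, ?_, le_max_left _ _⟩
    have : 0 < (p : ℝ) ^ k := by positivity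
    exact max_lt (by linarith) (by norm_num)
  have hlim : Tendsto (fun n : ℕ ↦ ENNReal.ofReal ((n : ℝ) ^ k * r ^ n * (r ^ k)⁻¹))
      atTop (𝓝 0) := by
    rw [← ENNReal.ofReal_zero]
    refine ENNReal.tendsto_ofReal ?_
    rw [← zero_mul ((r ^ k)⁻¹)]
    exact (tendsto_pow_const_mul_const_pow_of_abs_lt_one k
      (by rwa [abs_of_pos hr0])).mul_const _
  refine tendsto_of_tendsto_of_tendsto_of_le_of_le' tendsto_const_nhds hlim
    (Eventually.of_forall fun _ ↦ zero_le) ?_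
  filter_upwards [eventually_ge_atTop k] with n hn
  refine (binomialRandom_not_hasCommonNbrs_le p hn).trans ?_
  have h1 : (1 - (toNNReal p : ENNReal) ^ k) ≤ ENNReal.ofReal r := by
    rw [tsub_le_iff_right]
    have h2 : (toNNReal p : ENNReal) = ENNReal.ofReal p := by
      rw [ENNReal.ofReal]; congr 1; ext; simp [hp.le]
    rw [h2, ← ENNReal.ofReal_pow hp.le, ← ENNReal.ofReal_add hr0.le (by positivity),
      ← ENNReal.ofReal_one]
    exact ENNReal.ofReal_le_ofReal (by linarith)
  calc (n : ENNReal) ^ k * (1 - (toNNReal p : ENNReal) ^ k) ^ (n - k)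
      ≤ (n : ENNReal) ^ k * ENNReal.ofReal r ^ (n - k) := by gcongr
    _ = ENNReal.ofReal ((n : ℝ) ^ k * r ^ (n - k)) := by
      rw [ENNReal.ofReal_mul (by positivity), ENNReal.ofReal_pow hr0.le,
        ENNReal.ofReal_pow (by positivity), ENNReal.ofReal_natCast]
    _ = ENNReal.ofReal ((n : ℝ) ^ k * r ^ n * (r ^ k)⁻¹) := by
      rw [mul_assoc, ← pow_sub₀ r hr0.ne' hn]

/-! ### Stability from a linear lower bound -/

theorem stable_of_hasCommonNbrs {W : Type*} {H : SimpleGraph W} (p : unitInterval) (hp0 : 0 < p)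
    (k N : ℕ) (h : ∀ n ≥ N, ∀ G : SimpleGraph (Fin n), HasCommonNbrs k G →
      wsat G H = wsat (⊤ : SimpleGraph (Fin n)) H) : Stable p H := by
  have h0 := ENNReal.Tendsto.sub (tendsto_const_nhds (x := (1 : ENNReal)))
    (tendsto_binomialRandom_not_hasCommonNbrs p hp0 k) (Or.inl ENNReal.one_ne_top)
  rw [tsub_zero] at h0
  refine tendsto_of_tendsto_of_tendsto_of_le_of_le' h0 tendsto_const_nhds ?_
    (Eventually.of_forall fun n ↦ MeasureTheory.prob_le_one)
  filter_upwards [eventually_ge_atTop N] with n hn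
  rw [tsub_le_iff_right, ← MeasureTheory.measure_univ (μ := SimpleGraph.binomialRandom (Fin n) p)]
  refine (MeasureTheory.measure_mono fun G _ ↦ ?_).trans (MeasureTheory.measure_union_le _ _)
  by_cases hG : HasCommonNbrs k G
  · exact Or.inl (h n hn G hG)
  · exact Or.inr hG

theorem stable_of_le_wsat {W : Type*} [Fintype W] {H : SimpleGraph W} [DecidableRel H.Adj]
    (p : unitInterval) (hp0 : 0 < p) {w₀ w₁ : W} (h₀₁ : H.Adj w₀ w₁) (C : ℕ)
    (hC : ∀ n, Fintype.card W ≤ n →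
      n * (H.degree w₀ - 1) ≤ wsat (⊤ : SimpleGraph (Fin n)) H + C) : Stable p H := by
  set d := H.degree w₀ - 1 with hd
  -- By `hC` the subtraction does not truncate for n ≥ |W|. The minimiser `m` does not depend on
  -- `n`, so the required `k` is constant.
  let g : ℕ → ℕ := fun n ↦ wsat (⊤ : SimpleGraph (Fin n)) H + C - n * d
  obtain ⟨m, hm, hmin⟩ : ∃ m, Fintype.card W ≤ m ∧ ∀ n, Fintype.card W ≤ n → g m ≤ g n := by
    have hne : (Set.Ici (Fintype.card W)).Nonempty := ⟨_, Set.self_mem_Ici⟩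
    exact ⟨Function.argminOn g _ hne, Function.argminOn_mem g _ hne,
      fun n hn ↦ Function.argminOn_le g _ hn⟩
  refine stable_of_hasCommonNbrs p hp0 (m + 2 * Fintype.card W + 2) m fun n hn G hG ↦ ?_
  refine le_antisymm ?_ (wsat_top_le (hG.weaklySaturated_top h₀₁ (by omega)))
  have h1 := hG.wsat_le h₀₁ hm le_rfl
  have h2 := hmin n (hm.trans hn)
  have h3 := hC m hm
  have h4 := hC n (hm.trans hn)
  rw [Fintype.card_fin, ← hd, Nat.sub_mul] at h1
  have h5 : m * d ≤ n * d := Nat.mul_le_mul_right d hn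
  simp only [g] at h2
  omega

/-! ### Linear algebraic lower bound -/

/-- Every edge `ab` of `H` completes two families of `d` vertices, one adjacent to `b` and one
adjacent to `a`, that are joined completely to each other. -/
def HasBiclique {W : Type*} (d : ℕ) (H : SimpleGraph W) : Prop :=
  ∀ a b, H.Adj a b → ∃ I J : Fin d → W, I.Injective ∧ J.Injective ∧
    (∀ i, H.Adj b (I i) ∧ I i ≠ a) ∧ (∀ j, H.Adj a (J j) ∧ J j ≠ b) ∧
    ∀ i j, I i = J j ∨ H.Adj (I i) (J j)

/-- Expand `x a` over the `I` family and `x b` over the `J` family: both sides become the same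
double sum. -/
theorem dotProduct_comm_of_families {V : Type*} {d : ℕ} {φ x : V → Fin d → ℚ} {a b : V}
    {I J : Fin d → V} (hI : ∀ y, ∃ c : Fin d → ℚ, y = ∑ i, c i • x (I i))
    (hJ : ∀ y, ∃ c : Fin d → ℚ, y = ∑ j, c j • x (J j))
    (haJ : ∀ j, φ a ⬝ᵥ x (J j) = φ (J j) ⬝ᵥ x a) (hbI : ∀ i, φ b ⬝ᵥ x (I i) = φ (I i) ⬝ᵥ x b)
    (hIJ : ∀ i j, φ (I i) ⬝ᵥ x (J j) = φ (J j) ⬝ᵥ x (I i)) : φ a ⬝ᵥ x b = φ b ⬝ᵥ x a := by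
  obtain ⟨α, hα⟩ := hI (x a)
  obtain ⟨β, hβ⟩ := hJ (x b)
  calc φ a ⬝ᵥ x b = ∑ j, β j * (φ (J j) ⬝ᵥ x a) := by
        rw [hβ]; simp [dotProduct_sum, haJ]
    _ = ∑ j, ∑ i, β j * (α i * (φ (J j) ⬝ᵥ x (I i))) := by
        rw [hα]; simp [dotProduct_sum, Finset.mul_sum]
    _ = ∑ i, ∑ j, α i * (β j * (φ (I i) ⬝ᵥ x (J j))) := by
        rw [Finset.sum_comm]
        simp only [hIJ]
        exact Finset.sum_congr rfl fun _ _ ↦ Finset.sum_congr rfl fun _ _ ↦ by ring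
    _ = ∑ i, α i * (φ (I i) ⬝ᵥ x b) := by
        rw [hβ]; simp [dotProduct_sum, Finset.mul_sum]
    _ = φ b ⬝ᵥ x a := by
        rw [hα]; simp [dotProduct_sum, hbI]

theorem HasBiclique.dotProduct_comm {V W : Type*} {d : ℕ} {H : SimpleGraph W}
    (hH : HasBiclique d H) {φ x : V → Fin d → ℚ}
    (hx : ∀ I : Fin d → V, I.Injective → ∀ y, ∃ c : Fin d → ℚ, y = ∑ i, c i • x (I i))
    {F F' : SimpleGraph V} (hF : Relation.ReflTransGen (Step H) F F')
    (hφ : ∀ u v, F.Adj u v → φ u ⬝ᵥ x v = φ v ⬝ᵥ x u) (u v : V) (huv : F'.Adj u v) :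
    φ u ⬝ᵥ x v = φ v ⬝ᵥ x u := by
  induction hF generalizing u v with
  | refl => exact hφ u v huv
  | tail _ hs ih =>
    rename_i A B _
    obtain ⟨u₀, v₀, -, -, rfl, f, a, b, hab, ha, hb⟩ := hs
    have hf : ∀ p q, H.Adj p q → p ≠ a → p ≠ b → φ (f p) ⬝ᵥ x (f q) = φ (f q) ⬝ᵥ x (f p) := by
      intro p q hpq hpa hpb
      have := f.toHom.map_adj hpq
      rw [SimpleGraph.sup_adj, SimpleGraph.edge_adj] at this
      rcases this with h | ⟨⟨h, -⟩ | ⟨h, -⟩, -⟩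
      · exact ih _ _ h
      · exact absurd (f.injective (h.trans ha.symm)) hpa
      · exact absurd (f.injective (h.trans hb.symm)) hpb
    have key : φ (f a) ⬝ᵥ x (f b) = φ (f b) ⬝ᵥ x (f a) := by
      obtain ⟨I, J, hI, hJ, hbI, haJ, hIJ⟩ := hH a b hab
      refine dotProduct_comm_of_families (I := f ∘ I) (J := f ∘ J)
        (hx _ (f.injective.comp hI)) (hx _ (f.injective.comp hJ)) ?_ ?_ ?_
      · exact fun j ↦ (hf (J j) a (haJ j).1.symm (haJ j).1.ne' (haJ j).2).symm
      · exact fun i ↦ (hf (I i) b (hbI i).1.symm (hbI i).2 (hbI i).1.ne').symm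
      · intro i j
        rcases hIJ i j with h | h
        · simp [h]
        · exact hf (I i) (J j) h (hbI i).2 (hbI i).1.ne'
    rw [ha, hb] at key
    rw [SimpleGraph.sup_adj, SimpleGraph.edge_adj] at huv
    rcases huv with h | ⟨⟨rfl, rfl⟩ | ⟨rfl, rfl⟩, -⟩
    · exact ih _ _ h
    · exact key
    · exact key.symm

theorem exists_eq_sum_smul_pow {d n : ℕ} (I : Fin d → Fin n) (hI : I.Injective)
    (y : Fin d → ℚ) : ∃ c : Fin d → ℚ, y = ∑ i, c i • fun j : Fin d ↦ ((I i : ℕ) : ℚ) ^ (j : ℕ) := by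
  set M := Matrix.vandermonde fun i ↦ ((I i : ℕ) : ℚ)
  have hM : IsUnit M.det := by
    rw [isUnit_iff_ne_zero, Matrix.det_vandermonde_ne_zero_iff]
    intro i j hij
    exact hI (Fin.ext (Nat.cast_injective hij))
  refine ⟨Matrix.vecMul y M⁻¹, ?_⟩
  have h : Matrix.vecMul (Matrix.vecMul y M⁻¹) M = y := by
    rw [Matrix.vecMul_vecMul, Matrix.nonsing_inv_mul M hM, Matrix.vecMul_one]
  conv_lhs => rw [← h]
  ext j
  simp [Matrix.vecMul, dotProduct, M, Matrix.vandermonde_apply]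

/-- Take `x` on the moment curve, so any `d` vertices give a basis. Symmetry of `φ u ⬝ᵥ x v` on the
edges of `F` spreads along the process to all pairs. If `φ` also vanishes on the first `d` vertices,
each `φ v` is orthogonal to a basis, so `φ = 0`. Thus |E(F)| + d² linear conditions determine nd
unknowns. -/
theorem HasBiclique.mul_le_ncard_edgeSet {W : Type*} {d n : ℕ} {H : SimpleGraph W}
    (hH : HasBiclique d H) (hdn : d ≤ n) {F : SimpleGraph (Fin n)}
    (hF : WeaklySaturated ⊤ H F) : n * d ≤ F.edgeSet.ncard + d * d := by
  classical
  let x : Fin n → Fin d → ℚ := fun i j ↦ ((i : ℕ) : ℚ) ^ (j : ℕ)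
  let T : (Fin n → Fin d → ℚ) →ₗ[ℚ] (F.edgeSet → ℚ) × (Fin d → Fin d → ℚ) :=
    { toFun := fun φ ↦
        (fun e ↦ φ e.1.out.1 ⬝ᵥ x e.1.out.2 - φ e.1.out.2 ⬝ᵥ x e.1.out.1,
          fun j ↦ φ (Fin.castLE hdn j))
      map_add' := fun φ ψ ↦ by
        ext
        · simp only [Pi.add_apply, add_dotProduct, Prod.mk_add_mk]; ring
        · simp
      map_smul' := fun c φ ↦ by
        ext
        · simp only [Pi.smul_apply, smul_dotProduct, Prod.smul_mk, RingHom.id_apply, smul_eq_mul]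
          ring
        · simp }
  have hT : Function.Injective T := by
    rw [← LinearMap.ker_eq_bot, LinearMap.ker_eq_bot']
    intro φ hφ
    have h1 : ∀ e : F.edgeSet, φ e.1.out.1 ⬝ᵥ x e.1.out.2 - φ e.1.out.2 ⬝ᵥ x e.1.out.1 = 0 :=
      fun e ↦ congrFun (congrArg Prod.fst hφ) e
    have h2 : ∀ j : Fin d, φ (Fin.castLE hdn j) = 0 := fun j ↦ congrFun (congrArg Prod.snd hφ) j
    have h3 : ∀ u v, F.Adj u v → φ u ⬝ᵥ x v = φ v ⬝ᵥ x u := by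
      intro u v huv
      have h := h1 ⟨s(u, v), huv⟩
      have h' : s((s(u, v)).out.1, (s(u, v)).out.2) = s(u, v) := Quot.out_eq _
      rw [Sym2.eq_iff] at h'
      rcases h' with ⟨h3, h4⟩ | ⟨h3, h4⟩
      · simp only [h3, h4] at h; exact sub_eq_zero.1 h
      · simp only [h3, h4] at h; exact (sub_eq_zero.1 h).symm
    have h4 := hH.dotProduct_comm (x := x) (fun I hI y ↦ exists_eq_sum_smul_pow I hI y) hF.2 h3
    funext v
    rw [Pi.zero_apply, ← dotProduct_eq_zero_iff]
    intro y
    obtain ⟨c, rfl⟩ := exists_eq_sum_smul_pow (Fin.castLE hdn) (Fin.castLE_injective hdn) y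
    rw [dotProduct_sum]
    refine Finset.sum_eq_zero fun j _ ↦ ?_
    rw [dotProduct_smul]
    have : φ v ⬝ᵥ x (Fin.castLE hdn j) = 0 := by
      by_cases hv : v = Fin.castLE hdn j
      · rw [hv, h2, zero_dotProduct]
      · rw [h4 v _ hv, h2, zero_dotProduct]
    exact (congrArg (c j • ·) this).trans (smul_zero _)
  have := LinearMap.finrank_le_finrank_of_injective hT
  simp only [Module.finrank_prod, Module.finrank_pi_fintype, Module.finrank_self, Finset.sum_const,
    Finset.card_univ, Fintype.card_fin, smul_eq_mul, mul_one] at this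
  rwa [← Nat.card_eq_fintype_card, Nat.card_coe_set_eq] at this

theorem HasBiclique.stable {W : Type*} [Fintype W] {d : ℕ} {H : SimpleGraph W}
    [DecidableRel H.Adj] (hH : HasBiclique d H) (p : unitInterval) (hp0 : 0 < p) {w₀ w₁ : W}
    (h₀₁ : H.Adj w₀ w₁) (hd : H.degree w₀ = d + 1) : Stable p H := by
  refine stable_of_le_wsat p hp0 h₀₁ (d * d) fun n hn ↦ ?_
  have hlt := H.degree_lt_card_verts w₀
  obtain ⟨F, hF, hcard⟩ := exists_isMinWeaklySaturated (⊤ : SimpleGraph (Fin n)) H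
  rw [← hcard, hd, Nat.add_sub_cancel]
  exact hH.mul_le_ncard_edgeSet (by omega) hF

/-! ### Cliques and complete bipartite graphs -/

theorem hasBiclique_top (d : ℕ) : HasBiclique d (⊤ : SimpleGraph (Fin (d + 2))) := by
  intro a b hab
  have hcard : ({a, b}ᶜ : Finset (Fin (d + 2))).card = d := by
    rw [Finset.card_compl, Finset.card_pair hab, Fintype.card_fin]
    omega
  set I := Finset.orderEmbOfFin _ hcard
  have hI : ∀ i, I i ≠ a ∧ I i ≠ b := fun i ↦ by
    have := Finset.orderEmbOfFin_mem _ hcard i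
    simpa only [Finset.mem_compl, Finset.mem_insert, Finset.mem_singleton, not_or] using this
  exact ⟨I, I, I.injective, I.injective, fun i ↦ ⟨(hI i).2.symm, (hI i).1⟩,
    fun i ↦ ⟨(hI i).1.symm, (hI i).2⟩, fun i j ↦ em _⟩

theorem hasBiclique_completeBipartiteGraph {d e : ℕ} (hde : d ≤ e) :
    HasBiclique d (completeBipartiteGraph (Fin (d + 1)) (Fin (e + 1))) := by
  have key : ∀ i : Fin (d + 1), ∀ j : Fin (e + 1), ∃ I : Fin d → Fin (d + 1),
      ∃ J : Fin d → Fin (e + 1), I.Injective ∧ J.Injective ∧ (∀ k, I k ≠ i) ∧ ∀ k, J k ≠ j :=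
    fun i j ↦ ⟨i.succAbove, j.succAbove ∘ Fin.castLE hde, Fin.succAbove_right_injective,
      Fin.succAbove_right_injective.comp (Fin.castLE_injective hde),
      fun k ↦ Fin.succAbove_ne i k, fun k ↦ Fin.succAbove_ne j _⟩
  rintro (i | i) (j | j) hab
  · simp at hab
  · obtain ⟨I, J, hI, hJ, hIi, hJj⟩ := key i j
    exact ⟨Sum.inl ∘ I, Sum.inr ∘ J, Sum.inl_injective.comp hI, Sum.inr_injective.comp hJ,
      by simp [hIi], by simp [hJj], by simp⟩
  · obtain ⟨I, J, hI, hJ, hIi, hJj⟩ := key j i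
    exact ⟨Sum.inr ∘ J, Sum.inl ∘ I, Sum.inr_injective.comp hJ, Sum.inl_injective.comp hI,
      by simp [hJj], by simp [hIi], by simp⟩
  · simp at hab

theorem stable_completeBipartiteGraph (p : unitInterval) (hp0 : 0 < p) {d e : ℕ} (hde : d ≤ e) :
    Stable p (completeBipartiteGraph (Fin (d + 1)) (Fin (e + 1))) := by
  classical
  -- `w₀` lies on the larger side, so its degree is the size `d + 1` of the smaller one.
  refine (hasBiclique_completeBipartiteGraph hde).stable p hp0 (w₀ := Sum.inr 0) (w₁ := Sum.inl 0)
    (by simp) ?_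
  rw [← SimpleGraph.card_neighborFinset_eq_degree]
  have : (completeBipartiteGraph (Fin (d + 1)) (Fin (e + 1))).neighborFinset (Sum.inr 0) =
      Finset.univ.map Function.Embedding.inl := by
    ext (i | i) <;> simp
  simp [this]

/-! ### Lower bound from a core, and the main theorem -/

theorem HasCore.mul_le_ncard_edgeSet {C d n : ℕ} {F : SimpleGraph (Fin n)} (hF : HasCore C d F) :
    n * d ≤ F.edgeSet.ncard + C * d := by
  classical
  obtain ⟨S, hSC, hS⟩ := hF
  set N : Fin n → Finset (Fin n) := fun v ↦ S.filter (F.Adj v) with hN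
  have hNcard : ∀ v ∈ Finset.univ \ S, d ≤ ((N v).image fun u ↦ s(v, u)).card := by
    intro v hv
    rw [Finset.card_image_of_injective _ fun u u' h ↦ Sym2.congr_right.1 h]
    have := hS v (by simpa using hv)
    rwa [show {u | u ∈ S ∧ F.Adj v u} = ((N v : Finset (Fin n)) : Set (Fin n)) by ext; simp [hN],
      Set.ncard_coe_finset] at this
  have hdisj : ((Finset.univ \ S : Finset (Fin n)) : Set (Fin n)).PairwiseDisjoint
      fun v ↦ (N v).image fun u ↦ s(v, u) := by
    intro v hv w hw hvw
    rw [Function.onFun, Finset.disjoint_left]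
    simp only [Finset.mem_image, not_exists, not_and]
    rintro _ ⟨x, hx, rfl⟩ y hy h
    have hvS : v ∉ S := by simpa using hv
    rw [Sym2.eq_iff] at h
    rcases h with ⟨h, -⟩ | ⟨-, h⟩
    · exact hvw h.symm
    · exact hvS (h ▸ (Finset.mem_filter.1 hy).1)
  have h1 := Finset.card_nsmul_le_sum _ _ _ hNcard
  rw [← Finset.card_biUnion hdisj, Finset.card_sdiff_of_subset (Finset.subset_univ S),
    Finset.card_univ, Fintype.card_fin, smul_eq_mul] at h1
  have h2 : ((Finset.univ \ S).biUnion fun v ↦ (N v).image fun u ↦ s(v, u)) ⊆ F.edgeFinset := by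
    intro e he
    simp only [Finset.mem_biUnion, Finset.mem_image, hN, Finset.mem_filter] at he
    obtain ⟨v, -, u, ⟨-, hu⟩, rfl⟩ := he
    simpa using hu
  have h3 := Finset.card_le_card h2
  rw [← Set.ncard_coe_finset F.edgeFinset, SimpleGraph.coe_edgeFinset] at h3
  have h4 : n * d ≤ (n - S.card) * d + S.card * d := by
    rw [← Nat.add_mul]
    exact Nat.mul_le_mul_right d (by omega)
  have h5 := Nat.mul_le_mul_right d hSC
  omega

end WeakSat

theorem mainTheorem2 (p : unitInterval) (hp0 : 0 < p) (hp1 : p < 1) :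
    (∀ (W : Type*) [Fintype W] [Nonempty W] (H : SimpleGraph W) [DecidableRel H.Adj],
      (∀ w : W, ¬ H.IsIsolated w) →
      (∃ C : ℕ, ∀ n : ℕ, ∃ F : SimpleGraph (Fin n),
        WeakSat.IsMinWeaklySaturated (⊤ : SimpleGraph (Fin n)) H F ∧
        WeakSat.HasCore C (H.minDegree - 1) F) →
      WeakSat.Stable p H) ∧
    (∀ s : ℕ, 2 ≤ s → WeakSat.Stable p (⊤ : SimpleGraph (Fin s))) ∧
    (∀ t : ℕ, 1 ≤ t → WeakSat.Stable p (completeBipartiteGraph (Fin t) (Fin t))) ∧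
    (∀ t : ℕ, 1 ≤ t → WeakSat.Stable p (completeBipartiteGraph (Fin t) (Fin (t + 1)))) := by
  refine ⟨?_, ?_, ?_, ?_⟩
  · rintro W _ _ H _ hH ⟨C, hC⟩
    obtain ⟨w₀, hw₀⟩ := H.exists_minimal_degree_vertex
    obtain ⟨w₁, h₀₁⟩ : ∃ w₁, H.Adj w₀ w₁ := by
      simpa [SimpleGraph.IsIsolated] using hH w₀
    refine WeakSat.stable_of_le_wsat p hp0 h₀₁ (C * (H.degree w₀ - 1)) fun n _ ↦ ?_
    obtain ⟨F, ⟨-, hcard⟩, hcore⟩ := hC n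
    rw [← hcard, ← hw₀]
    exact hcore.mul_le_ncard_edgeSet
  · intro s hs
    obtain ⟨d, rfl⟩ := Nat.exists_eq_add_of_le' hs
    exact (WeakSat.hasBiclique_top d).stable p hp0 (w₀ := 0) (w₁ := 1) (by simp) (by simp)
  · intro t ht
    obtain ⟨d, rfl⟩ := Nat.exists_eq_add_of_le' ht
    exact WeakSat.stable_completeBipartiteGraph p hp0 le_rfl
  · intro t ht
    obtain ⟨d, rfl⟩ := Nat.exists_eq_add_of_le' ht
    exact WeakSat.stable_completeBipartiteGraph p hp0 (Nat.le_succ d)
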